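/- Fix countable supplies of variables, function symbols and predicate symbols, each function and predicate symbol having an arity $k\ge 0$. A program $P$ is a finite set of disjunctive rules $$p_1(\bar t_1)\vee\cdots\vee p_n(\bar t_n)\ \text{:-}\ q_1(\bar s_1),\dots,q_j(\bar s_j),\ \mathtt{not}\ q_{j+1}(\bar s_{j+1}),\dots,\mathtt{not}\ q_m(\bar s_m)\qquad(n\ge 1,\ m\ge j\ge 0)$$ whose atoms may contain variables and arbitrarily nested function symbols. A predicate in the head of a rule depends positively (negatively) on each predicate of an atom in the positive (negative) body of that rule; $P$ is stratified if no cycle of dependencies contains a negative dependency. Let $U_P$ be the set of ground terms built from the function symbols appearing in $P$, let $B_P$ be the set of atoms with a predicate appearing in $P$ and arguments in $U_P$, and let $\mathrm{Ground}(P)$ be the set of all instances of rules of $P$ under substitutions of their variables by elements of $U_P$. A stable model of $P$ is a set $M\subseteq B_P$ that is a subset-minimal model of the reduct $\mathrm{Ground}(P)^M$, which is obtained from $\mathrm{Ground}(P)$ by deleting every rule having a negative body atom in $M$ and then removing the negative literals from the remaining rules. A query is a ground atom $Q$; $P$ cautiously (bravely) entails $Q$ if $Q\in M$ for all (for some) stable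 models $M$ of $P$. The atoms relevant for $Q$ are $Q$ itself and every atom of any rule of $\mathrm{Ground}(P)$ having a relevant atom in its head; $Q$ is finitely recursive on $P$ if only finitely many ground atoms are relevant for $Q$. Theorem. Cautious and brave entailment are decidable for finitely recursive queries over stratified programs. That is, there is an algorithm (a partial recursive function) which, given any stratified program $P$ and any ground query $Q$ that is finitely recursive on $P$, halts and correctly tells whether $P$ cautiously entails $Q$; and there is an algorithm which, for all such inputs, halts and correctly tells whether $P$ bravely entails $Q$. (The algorithms receive $P$ and $Q$ as input; nothing is required of them on other inputs.) -/

import Mathlib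

namespace ASP

/-! ### Syntax

Function symbols and predicate symbols are pairs (name, arity), with names taken from a
countable supply; a symbol used with `k` arguments has arity `k`. -/

/-- Terms: variables and functional terms `f(t₁, …, t_k)`, `k ≥ 0` (`k = 0`: constants). -/
inductive Term : Type
  | var (x : ℕ) : Term
  | fn (f : ℕ) (ts : List Term) : Term

namespace Term

/-- The variables occurring in a term. -/
def vars : Term → List ℕ
  | var x => [x]
  | fn _ ts => ts.flatMap vars

/-- The function symbols, as pairs (name, arity), occurring in a term. -/
def functors : Term → List (ℕ × ℕ)
  | var _ => []
  | fn f ts => (f, ts.length) :: ts.flatMap functors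

/-- Application of a substitution to a term. -/
def subst (σ : ℕ → Term) : Term → Term
  | var x => σ x
  | fn f ts => fn f (ts.map (subst σ))

end Term

/-- Atoms `p(t₁, …, t_k)`, `k ≥ 0`. -/
structure Atom : Type where
  /-- the name of the predicate -/
  name : ℕ
  /-- the arguments -/
  args : List Term

namespace Atom

/-- The predicate symbol of an atom, as a pair (name, arity). -/
def pred (a : Atom) : ℕ × ℕ := (a.name, a.args.length)

/-- The variables occurring in an atom. -/
def vars (a : Atom) : List ℕ := a.args.flatMap Term.vars

/-- The function symbols occurring in an atom. -/
def functors (a : Atom) : List (ℕ × ℕ) := a.args.flatMap Term.functors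

/-- Application of a substitution to an atom. -/
def subst (σ : ℕ → Term) (a : Atom) : Atom := ⟨a.name, a.args.map (Term.subst σ)⟩

/-- An atom is ground if no variable occurs in it. -/
def IsGround (a : Atom) : Prop := a.vars = []

end Atom

/-- Disjunctive rules `p₁ v ⋯ v p_n :- q₁, …, q_j, not q_{j+1}, …, not q_m` with `n ≥ 1`. -/
structure Rule : Type where
  /-- the atoms of the disjunctive head -/
  head : List Atom
  /-- the head is not empty -/
  head_ne_nil : head ≠ []
  /-- the atoms of the positive body literals -/
  posBody : List Atom
  /-- the atoms of the negative body literals -/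
  negBody : List Atom

namespace Rule

/-- All atoms of a rule: head, positive body and negative body. -/
def atoms (r : Rule) : List Atom := r.head ++ r.posBody ++ r.negBody

/-- The variables occurring in a rule. -/
def vars (r : Rule) : List ℕ := r.atoms.flatMap Atom.vars

/-- Application of a substitution to a rule. -/
def subst (σ : ℕ → Term) (r : Rule) : Rule where
  head := r.head.map (Atom.subst σ)
  head_ne_nil := by simpa using r.head_ne_nil
  posBody := r.posBody.map (Atom.subst σ)
  negBody := r.negBody.map (Atom.subst σ)

/-- The rule without its negative body literals. -/
def positivePart (r : Rule) : Rule where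
  head := r.head
  head_ne_nil := r.head_ne_nil
  posBody := r.posBody
  negBody := []

end Rule

/-- A program is a finite set of rules, presented as a list. Everything below depends only
on which rules occur in the list. -/
abbrev Program : Type := List Rule

/-! ### Stratification -/

/-- `p` depends positively on `q`. -/
def DependsPos (P : Program) (p q : ℕ × ℕ) : Prop :=
  ∃ r ∈ P, (∃ a ∈ r.head, a.pred = p) ∧ ∃ b ∈ r.posBody, b.pred = q

/-- `p` depends negatively on `q`. -/
def DependsNeg (P : Program) (p q : ℕ × ℕ) : Prop :=
  ∃ r ∈ P, (∃ a ∈ r.head, a.pred = p) ∧ ∃ b ∈ r.negBody, b.pred = q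

/-- `p` depends, positively or negatively, on `q`. -/
def Depends (P : Program) (p q : ℕ × ℕ) : Prop := DependsPos P p q ∨ DependsNeg P p q

/-- A program is stratified if no cycle of dependencies contains a negative dependency. -/
def Stratified (P : Program) : Prop :=
  ¬ ∃ p q, DependsNeg P p q ∧ Relation.ReflTransGen (Depends P) q p

/-! ### Herbrand universe, base and grounding -/

/-- The function symbols appearing in a program. -/
def functors (P : Program) : Set (ℕ × ℕ) :=
  {f | ∃ r ∈ P, ∃ a ∈ r.atoms, f ∈ a.functors}

/-- The predicate symbols appearing in a program. -/
def preds (P : Program) : Set (ℕ × ℕ) :=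
  {p | ∃ r ∈ P, ∃ a ∈ r.atoms, a.pred = p}

/-- Membership of a term in the universe `U_P`: the term is built from function symbols
appearing in `P` only. -/
inductive InUniverse (P : Program) : Term → Prop
  | fn (f : ℕ) (ts : List Term) (hf : (f, ts.length) ∈ functors P)
      (hts : ∀ t ∈ ts, InUniverse P t) : InUniverse P (Term.fn f ts)

/-- The base `B_P`: the atoms with a predicate appearing in `P` and arguments in `U_P`. -/
def base (P : Program) : Set Atom :=
  {a | a.pred ∈ preds P ∧ ∀ t ∈ a.args, InUniverse P t}

/-- `Ground(P)`: the instances of the rules of `P` under the substitutions of their variables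
by elements of `U_P`. -/
def ground (P : Program) : Set Rule :=
  {r' | ∃ r ∈ P, ∃ σ : ℕ → Term, (∀ x ∈ r.vars, InUniverse P (σ x)) ∧ r' = r.subst σ}

/-! ### Stable models and entailment -/

/-- The body of a ground rule is true with respect to `I`. -/
def BodyTrue (I : Set Atom) (r : Rule) : Prop :=
  (∀ a ∈ r.posBody, a ∈ I) ∧ ∀ a ∈ r.negBody, a ∉ I

/-- `I` satisfies a ground rule. -/
def Satisfies (I : Set Atom) (r : Rule) : Prop :=
  BodyTrue I r → ∃ a ∈ r.head, a ∈ I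

/-- `I` is a model of a set of ground rules. -/
def IsModel (I : Set Atom) (S : Set Rule) : Prop := ∀ r ∈ S, Satisfies I r

/-- The reduct of a set of ground rules with respect to `I`: drop the rules with a negative
body atom that belongs to `I`, and the negative literals of the remaining rules. -/
def reduct (S : Set Rule) (I : Set Atom) : Set Rule :=
  {r' | ∃ r ∈ S, (∀ a ∈ r.negBody, a ∉ I) ∧ r' = r.positivePart}

/-- `M` is a stable model of `P`: an interpretation (a subset of `B_P`) that is a
subset-minimal model of the reduct of `Ground(P)` with respect to `M`. -/
def IsStableModel (P : Program) (M : Set Atom) : Prop :=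
  M ⊆ base P ∧ IsModel M (reduct (ground P) M) ∧
    ∀ N : Set Atom, N ⊆ M → IsModel N (reduct (ground P) M) → N = M

/-- `P` cautiously entails the ground atom `Q`: `Q` is true in all stable models. -/
def CautiouslyEntails (P : Program) (Q : Atom) : Prop :=
  ∀ M : Set Atom, IsStableModel P M → Q ∈ M

/-- `P` bravely entails the ground atom `Q`: `Q` is true in some stable model. -/
def BravelyEntails (P : Program) (Q : Atom) : Prop :=
  ∃ M : Set Atom, IsStableModel P M ∧ Q ∈ M

/-! ### Finitely recursive queries -/

/-- The atoms relevant for the query `Q` on `P`. -/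
inductive Relevant (P : Program) (Q : Atom) : Atom → Prop
  | query : Relevant P Q Q
  | step (r : Rule) (hr : r ∈ ground P) (h : Atom) (hh : h ∈ r.head) (hrel : Relevant P Q h)
      (a : Atom) (ha : a ∈ r.atoms) : Relevant P Q a

/-- `Q` is finitely recursive on `P` if only finitely many ground atoms are relevant for it. -/
def FinitelyRecursive (P : Program) (Q : Atom) : Prop := {a | Relevant P Q a}.Finite

/-! ### Coding of programs and queries, and decidability

Terms are coded bijectively by natural numbers: `var x` by `2 x`, and `f(t₁, …, t_k)` by
`2 ⟨f, c⟩ + 1`, where `c` is the usual code of the list of the codes of `t₁, …, t_k`. -/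

namespace Term

/-- Code of a term. -/
def toNat : Term → ℕ
  | var x => 2 * x
  | fn f ts => 2 * Nat.pair f (Encodable.encode (ts.map toNat)) + 1

mutual

/-- The term with a given code. -/
def ofNat (n : ℕ) : Term :=
  if n % 2 = 0 then var (n / 2)
  else fn (n / 2).unpair.1 (listOfNat (n / 2).unpair.2)
termination_by n
decreasing_by
  have h := Nat.unpair_right_le (n / 2)
  omega

/-- The list of terms with a given code. -/
def listOfNat : ℕ → List Term
  | 0 => []
  | m + 1 => ofNat m.unpair.1 :: listOfNat m.unpair.2
termination_by m => m
decreasing_by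
  · exact Nat.lt_succ_of_le (Nat.unpair_left_le m)
  · exact Nat.lt_succ_of_le (Nat.unpair_right_le m)

end

theorem listOfNat_encode (ts : List Term) (h : ∀ t ∈ ts, ofNat (toNat t) = t) :
    listOfNat (Encodable.encode (ts.map toNat)) = ts := by
  induction ts with
  | nil => simp [listOfNat]
  | cons t ts ih =>
    simp only [List.map_cons, Encodable.encode_list_cons, Nat.succ_eq_add_one, listOfNat,
      Nat.unpair_pair, Encodable.encode_nat]
    rw [h t (by simp), ih fun t ht => h t (by simp [ht])]

theorem ofNat_toNat : ∀ t : Term, ofNat (toNat t) = t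
  | var x => by
    rw [toNat, ofNat]
    simp
  | fn f ts => by
    have h := listOfNat_encode ts fun t _ => ofNat_toNat t
    rw [toNat, ofNat]
    have h1 : ∀ k : ℕ, (2 * k + 1) / 2 = k := fun k => by omega
    have h2 : ∀ k : ℕ, ¬ (2 * k + 1) % 2 = 0 := fun k => by omega
    rw [if_neg (h2 _), h1, Nat.unpair_pair, h]

mutual

theorem toNat_ofNat (n : ℕ) : toNat (ofNat n) = n := by
  rw [ofNat]
  split
  · rw [toNat]; omega
  · rw [toNat, encode_listOfNat (n / 2).unpair.2, Nat.pair_unpair]; omega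
termination_by n
decreasing_by
  have h := Nat.unpair_right_le (n / 2)
  omega

theorem encode_listOfNat : ∀ m : ℕ, Encodable.encode ((listOfNat m).map toNat) = m
  | 0 => by simp [listOfNat]
  | m + 1 => by
    rw [listOfNat, List.map_cons, Encodable.encode_list_cons, toNat_ofNat m.unpair.1,
      encode_listOfNat m.unpair.2, Encodable.encode_nat, Nat.pair_unpair]
termination_by m => m
decreasing_by
  · exact Nat.lt_succ_of_le (Nat.unpair_left_le m)
  · exact Nat.lt_succ_of_le (Nat.unpair_right_le m)

end

/-- The bijective coding of terms. -/
def equivNat : Term ≃ ℕ := ⟨toNat, ofNat, ofNat_toNat, toNat_ofNat⟩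

instance : Primcodable Term := Primcodable.ofEquiv ℕ equivNat

end Term

/-- An atom as a pair. -/
def Atom.equivProd : Atom ≃ ℕ × List Term where
  toFun a := (a.name, a.args)
  invFun p := ⟨p.1, p.2⟩
  left_inv _ := rfl
  right_inv _ := rfl

instance : Primcodable Atom := Primcodable.ofEquiv (ℕ × List Term) Atom.equivProd

/-- A rule as a tuple: first head atom, other head atoms, positive body, negative body. -/
def Rule.equivProd : Rule ≃ (Atom × List Atom) × List Atom × List Atom where
  toFun r := ((r.head.head r.head_ne_nil, r.head.tail), r.posBody, r.negBody)
  invFun p := ⟨p.1.1 :: p.1.2, by simp, p.2.1, p.2.2⟩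
  left_inv r := by cases r; simp
  right_inv _ := rfl

instance : Primcodable Rule :=
  Primcodable.ofEquiv ((Atom × List Atom) × List Atom × List Atom) Rule.equivProd

/-- The property `p` is decidable by an algorithm on the inputs in the class `D`: some partial
recursive function halts on every input in `D` and tells whether `p` holds there. (Nothing
is required on inputs outside `D`, and membership in `D` need not be decidable.) -/
def DecidableOn {α : Type*} [Primcodable α] (D p : α → Prop) : Prop :=
  ∃ f : α →. Bool, Partrec f ∧ ∀ a, D a → ∃ b ∈ f a, (b = true ↔ p a)

/-- The pairs of a stratified program and a ground query that is finitely recursive on it. -/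
def IsFinitelyRecursiveInstance (x : Program × Atom) : Prop :=
  Stratified x.1 ∧ x.2.IsGround ∧ FinitelyRecursive x.1 x.2

end ASP

namespace ASP

/-! ### Answer sets of sets of ground rules and splitting -/

-- Call a set `R` of ground atoms closed if every ground rule with a head atom in `R` has all its
-- atoms in `R`. Closed sets split programs. The trace on `R` of a stable model is an answer set of
-- the rules with a head in `R` (`IsAnswerSet.inter`). For a stratified program every answer set of
-- those rules conversely extends to a stable model (`IsAnswerSet.exists_extension`), by minimizing
-- level by level. So either entailment of `Q` depends only on the answer sets of the rules over any
-- one closed set containing `Q`, and these are finitely many if the set is finite.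
--
-- The relevant atoms form such a set, but no algorithm has to compute them: any finite closed `R`
-- containing `Q` will do, and it can be found by search. The difficulty is to recognize closedness
-- when the Herbrand universe is infinite. A certificate is a pair `(K, R)` for which closedness is
-- checked only on instances with term codes below `K`. If some ground term `u` below `K` has a
-- larger code than every argument in `R`, then `u` can stand for all large terms, so the bounded
-- check is enough (`IsCertificate.closedUnder_ground`). Certificates are primitive recursively
-- recognizable and exist for finitely recursive queries (`exists_isCertificate`), so the search
-- halts. Then all candidate sublists of `R` are tested.

/-- `M` is a subset-minimal model of the reduct of `S` with respect to `M`. -/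
def IsAnswerSet (S : Set Rule) (M : Set Atom) : Prop :=
  IsModel M (reduct S M) ∧ ∀ N : Set Atom, N ⊆ M → IsModel N (reduct S M) → N = M

/-- Every rule of `S` with a head atom in `R` has all its atoms in `R`. -/
def ClosedUnder (S : Set Rule) (R : Set Atom) : Prop :=
  ∀ r ∈ S, (∃ h ∈ r.head, h ∈ R) → ∀ a ∈ r.atoms, a ∈ R

/-- The rules of `S` with a head atom in `R`. -/
def bottom (S : Set Rule) (R : Set Atom) : Set Rule := {r ∈ S | ∃ h ∈ r.head, h ∈ R}

theorem isModel_reduct_iff {S : Set Rule} {N M : Set Atom} :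
    IsModel N (reduct S M) ↔ ∀ r ∈ S, (∀ a ∈ r.negBody, a ∉ M) → (∀ a ∈ r.posBody, a ∈ N) →
      ∃ a ∈ r.head, a ∈ N := by
  constructor
  · intro h r hr hn hp
    exact h r.positivePart ⟨r, hr, hn, rfl⟩ ⟨hp, by simp [Rule.positivePart]⟩
  · rintro h _ ⟨r, hr, hn, rfl⟩ ⟨hp, -⟩
    exact h r hr hn hp

theorem Rule.mem_atoms {r : Rule} {a : Atom} :
    a ∈ r.atoms ↔ a ∈ r.head ∨ a ∈ r.posBody ∨ a ∈ r.negBody := by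
  simp [Rule.atoms]

theorem Rule.exists_mem_head (r : Rule) : ∃ h, h ∈ r.head :=
  List.exists_mem_of_ne_nil _ r.head_ne_nil

/-- Discarding the atoms of `M` outside `B` leaves a model of the reduct, since heads lie in `B`;
minimality forbids a proper loss. -/
theorem IsAnswerSet.subset {S : Set Rule} {M B : Set Atom} (hM : IsAnswerSet S M)
    (hB : ∀ r ∈ S, ∀ h ∈ r.head, h ∈ B) : M ⊆ B := by
  have := hM.2 (M ∩ B) Set.inter_subset_left (isModel_reduct_iff.2 fun r hr hn hp => by
    obtain ⟨a, ha, haM⟩ := isModel_reduct_iff.1 hM.1 r hr hn fun a ha => (hp a ha).1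
    exact ⟨a, ha, haM, hB r hr a ha⟩)
  exact Set.inter_eq_left.1 this

/-- The restriction of an answer set to a closed set is an answer set of the bottom. -/
theorem IsAnswerSet.inter {S : Set Rule} {M R : Set Atom} (hM : IsAnswerSet S M)
    (hR : ClosedUnder S R) : IsAnswerSet (bottom S R) (M ∩ R) := by
  have hmod := isModel_reduct_iff.1 hM.1
  refine ⟨isModel_reduct_iff.2 ?_, fun Y hY hmY => ?_⟩
  · rintro r ⟨hr, hh⟩ hn hp
    have hat := hR r hr hh
    obtain ⟨a, ha, haM⟩ := hmod r hr
      (fun a ha haM => hn a ha ⟨haM, hat a (Rule.mem_atoms.2 (.inr (.inr ha)))⟩)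
      fun a ha => (hp a ha).1
    exact ⟨a, ha, haM, hat a (Rule.mem_atoms.2 (.inl ha))⟩
  · have hmY := isModel_reduct_iff.1 hmY
    -- A smaller model `Y` of the bottom would give a smaller model of the whole reduct: replace the
    -- part of `M` in `R` by `Y` and keep the rest.
    have hsub : Y ∪ (M \ R) ⊆ M :=
      Set.union_subset (hY.trans Set.inter_subset_left) Set.sdiff_subset
    have := hM.2 (Y ∪ (M \ R)) hsub (isModel_reduct_iff.2 fun r hr hn hp => by
      by_cases hh : ∃ h ∈ r.head, h ∈ R
      · have hat := hR r hr hh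
        obtain ⟨a, ha, haY⟩ := hmY r ⟨hr, hh⟩ (fun a ha h => hn a ha h.1) fun a ha =>
          (hp a ha).resolve_right fun h => h.2 (hat a (Rule.mem_atoms.2 (.inr (.inl ha))))
        exact ⟨a, ha, .inl haY⟩
      · obtain ⟨a, ha, haM⟩ := hmod r hr hn fun a ha => hsub (hp a ha)
        exact ⟨a, ha, .inr ⟨haM, fun h => hh ⟨a, ha, h⟩⟩⟩)
    refine hY.antisymm fun a ha => ?_
    have h1 : a ∈ Y ∪ (M \ R) := this.symm.subset ha.1
    exact h1.resolve_right fun h => h.2 ha.2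

theorem exists_mem_chain_forall_notMem {c : Set (Set Atom)} (hc : IsChain (· ⊆ ·) c)
    (hne : c.Nonempty) (l : List Atom) (hl : ∀ a ∈ l, a ∉ ⋂₀ c) :
    ∃ s ∈ c, ∀ a ∈ l, a ∉ s := by
  induction l with
  | nil => exact hne.imp fun s hs => ⟨hs, by simp⟩
  | cons a l ih =>
    obtain ⟨s, hs, hsl⟩ := ih fun b hb => hl b (by simp [hb])
    have ha := hl a (by simp)
    simp only [Set.mem_sInter, not_forall] at ha
    obtain ⟨t, ht, hat⟩ := ha
    rcases hc.total hs ht with h | h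
    · refine ⟨s, hs, ?_⟩
      simp only [List.mem_cons, forall_eq_or_imp]
      exact ⟨fun h' => hat (h h'), hsl⟩
    · refine ⟨t, ht, ?_⟩
      simp only [List.mem_cons, forall_eq_or_imp]
      exact ⟨hat, fun b hb h' => hsl b hb (h h')⟩

/-- A violated rule involves only finitely many head and negative body atoms. Along a chain a single
member omits them all, so that member would violate the rule too. -/
theorem isModel_sInter_chain {S : Set Rule} {c : Set (Set Atom)} (hc : IsChain (· ⊆ ·) c)
    (hne : c.Nonempty) (hm : ∀ s ∈ c, IsModel s S) : IsModel (⋂₀ c) S := by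
  rintro r hr ⟨hp, hn⟩
  by_contra hh
  push Not at hh
  obtain ⟨s, hs, hsl⟩ := exists_mem_chain_forall_notMem hc hne (r.head ++ r.negBody) (by
    intro a ha
    rcases List.mem_append.1 ha with h | h
    · exact hh a h
    · exact hn a h)
  obtain ⟨a, ha, has⟩ := hm s hs r hr
    ⟨fun a ha => hp a ha s hs, fun a ha => hsl a (by simp [ha])⟩
  exact hsl a (by simp [ha]) has

/-- The trace of `M` on the atoms of level `i` is minimal among the members of `F` that agree
with `M` below level `i`. -/
def MinimalAt (F : Set (Set Atom)) (level : Atom → ℕ) (i : ℕ) (M : Set Atom) : Prop :=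
  ∀ N ∈ F, (∀ a, level a < i → (a ∈ N ↔ a ∈ M)) → (∀ a, level a = i → a ∈ N → a ∈ M) →
    ∀ a, level a = i → a ∈ M → a ∈ N

theorem MinimalAt.congr {F : Set (Set Atom)} {level : Atom → ℕ} {i : ℕ} {M M' : Set Atom}
    (h : MinimalAt F level i M) (hMM' : ∀ a, level a ≤ i → (a ∈ M' ↔ a ∈ M)) :
    MinimalAt F level i M' := by
  intro N hN h1 h2 a ha haM
  exact h N hN (fun a ha => (h1 a ha).trans (hMM' a ha.le))
    (fun a ha h3 => (hMM' a ha.le).1 (h2 a ha h3)) a ha ((hMM' a ha.le).1 haM)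

/-- A family closed under intersections of chains and under adding all atoms of `T` from some
level on has a member minimal at all levels. -/
theorem exists_minimalAt {F : Set (Set Atom)} {T : Set Atom} {level : Atom → ℕ}
    (hne : F.Nonempty)
    (hchain : ∀ c ⊆ F, IsChain (· ⊆ ·) c → c.Nonempty → ⋂₀ c ∈ F)
    (hup : ∀ M ∈ F, ∀ i, M ∪ {a ∈ T | i ≤ level a} ∈ F)
    (hT : ∀ M ∈ F, ∀ N ∈ F, ∀ a ∈ N, a ∈ M ∨ a ∈ T) (k : ℕ) :
    ∃ M ∈ F, ∀ i < k, MinimalAt F level i M := by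
  induction k with
  | zero => exact hne.imp fun M hM => ⟨hM, by simp⟩
  | succ k ih =>
    obtain ⟨M, hM, hmin⟩ := ih
    -- Below level `k` members of `G` are frozen to agree with `M`, and above it they contain all of
    -- `T`. They can thus be compared at level `k` alone, and a minimal member exists by Zorn.
    let G : Set (Set Atom) := {N ∈ F | (∀ a, level a < k → (a ∈ N ↔ a ∈ M)) ∧
      ∀ a ∈ T, k + 1 ≤ level a → a ∈ N}
    have hG : M ∪ {a ∈ T | k ≤ level a} ∈ G := by
      refine ⟨hup M hM k, fun a ha => ?_, fun a ha hk => .inr ⟨ha, by omega⟩⟩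
      simp only [Set.mem_union, Set.mem_ofPred_eq, or_iff_left_iff_imp, and_imp]
      omega
    obtain ⟨N, -, hN⟩ := zorn_superset_nonempty G (fun c hc hcc hcne => by
      refine ⟨⋂₀ c, ⟨hchain c (fun s hs => (hc hs).1) hcc hcne, fun a ha => ?_, ?_⟩,
        fun s hs => Set.sInter_subset_of_mem hs⟩
      · constructor
        · intro h
          obtain ⟨s, hs⟩ := hcne
          exact ((hc hs).2.1 a ha).1 (h s hs)
        · exact fun h s hs => ((hc hs).2.1 a ha).2 h
      · exact fun a haT hk s hs => (hc hs).2.2 a haT hk) _ hG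
    refine ⟨N, hN.prop.1, fun i hi => ?_⟩
    rcases Nat.lt_succ_iff_lt_or_eq.1 hi with hi | rfl
    · exact (hmin i hi).congr fun a ha => hN.prop.2.1 a (by omega)
    · intro N' hN' h1 h2 a ha haN
      have hmem : N' ∪ {a ∈ T | i + 1 ≤ level a} ∈ G := by
        refine ⟨hup N' hN' _, fun a ha => ?_, fun a ha hk => .inr ⟨ha, hk⟩⟩
        rw [← hN.prop.2.1 a ha, ← h1 a ha]
        simp only [Set.mem_union, Set.mem_ofPred_eq, or_iff_left_iff_imp, and_imp]
        omega
      have hsub : N' ∪ {a ∈ T | i + 1 ≤ level a} ⊆ N := by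
        rintro b (hb | hb)
        · rcases lt_trichotomy (level b) i with h | h | h
          · exact (h1 b h).1 hb
          · exact h2 b h hb
          · rcases hT N hN.prop.1 N' hN' b hb with h' | h'
            · exact h'
            · exact hN.prop.2.2 b h' h
        · exact hN.prop.2.2 b hb.1 hb.2
      rcases hN.le_of_le hmem hsub haN with h | h
      · exact h
      · have := h.2
        omega

/-- Every answer set of the bottom of a stratified set of rules extends to an answer set. -/
theorem IsAnswerSet.exists_extension {S : Set Rule} {R X B : Set Atom} {level : Atom → ℕ} {k : ℕ}
    (hR : ClosedUnder S R) (hB : ∀ r ∈ S, ∀ h ∈ r.head, h ∈ B)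
    (hpos : ∀ r ∈ S, ∀ h ∈ r.head, ∀ b ∈ r.posBody, level b ≤ level h)
    (hneg : ∀ r ∈ S, ∀ h ∈ r.head, ∀ b ∈ r.negBody, level b < level h)
    (hk : ∀ a ∈ B, level a < k) (hX : IsAnswerSet (bottom S R) X) :
    ∃ M, IsAnswerSet S M ∧ M ∩ R = X := by
  have hXR : X ⊆ R := hX.subset fun r hr h hh => hR r hr.1 hr.2 h (Rule.mem_atoms.2 (.inl hh))
  have hXB : X ⊆ B := hX.subset fun r hr h hh => hB r hr.1 h hh
  have hXm := isModel_reduct_iff.1 hX.1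
  -- Models of the rules themselves, not of a reduct: the reduct changes with the candidate, and
  -- stratification bridges the gap at the end.
  let F : Set (Set Atom) := {M | M ⊆ B ∧ IsModel M S ∧ M ∩ R = X}
  have hbot : ∀ N : Set Atom, N ∩ R = X → ∀ r ∈ S, (∃ h ∈ r.head, h ∈ R) → Satisfies N r := by
    rintro N hN r hr hh ⟨hp, hn⟩
    have hat := hR r hr hh
    obtain ⟨a, ha, haX⟩ := hXm r ⟨hr, hh⟩ (fun a ha haX => hn a ha (hN ▸ haX : a ∈ N ∩ R).1)
      fun a ha => hN ▸ ⟨hp a ha, hat a (Rule.mem_atoms.2 (.inr (.inl ha)))⟩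
    exact ⟨a, ha, (hN ▸ haX : a ∈ N ∩ R).1⟩
  have hagree : ∀ M D : Set Atom, M ∩ R = X → D ⊆ B \ R → (M ∪ D) ∩ R = X := by
    intro M D hM hD
    rw [Set.union_inter_distrib_right, hM, Set.union_eq_left]
    exact fun a ha => absurd ha.2 (hD ha.1).2
  obtain ⟨M, ⟨hMB, hMmod, hMR⟩, hmin⟩ := exists_minimalAt (F := F) (T := B \ R) (level := level)
    ⟨X ∪ (B \ R), Set.union_subset hXB Set.sdiff_subset, fun r hr => by
        by_cases hh : ∃ h ∈ r.head, h ∈ R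
        · exact hbot _ (hagree X _ (Set.inter_eq_left.2 hXR) subset_rfl) r hr hh
        · obtain ⟨h, hh'⟩ := r.exists_mem_head
          exact fun _ => ⟨h, hh', .inr ⟨hB r hr h hh', fun h2 => hh ⟨h, hh', h2⟩⟩⟩,
      hagree X _ (Set.inter_eq_left.2 hXR) subset_rfl⟩
    (fun c hc hcc hcne => by
      refine ⟨?_, isModel_sInter_chain hcc hcne fun s hs => (hc hs).2.1, ?_⟩
      · obtain ⟨s, hs⟩ := hcne
        exact (Set.sInter_subset_of_mem hs).trans (hc hs).1
      · ext a
        constructor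
        · rintro ⟨h1, h2⟩
          obtain ⟨s, hs⟩ := hcne
          exact (hc hs).2.2 ▸ ⟨h1 s hs, h2⟩
        · intro ha
          exact ⟨fun s hs => ((hc hs).2.2 ▸ ha : a ∈ s ∩ R).1, hXR ha⟩)
    (fun M hM i => by
      have hR' : (M ∪ {a ∈ B \ R | i ≤ level a}) ∩ R = X := hagree M _ hM.2.2 fun a ha => ha.1
      refine ⟨Set.union_subset hM.1 fun a ha => ha.1.1, fun r hr => ?_, hR'⟩
      by_cases hh : ∃ h ∈ r.head, h ∈ R
      · exact hbot _ hR' r hr hh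
      · rintro ⟨hp, hn⟩
        push Not at hh
        -- A head atom of level at least `i` has been added. If there is none, the positive body
        -- lies below level `i`, hence already in `M`.
        by_cases hi : ∃ h ∈ r.head, i ≤ level h
        · obtain ⟨h, hh', hi⟩ := hi
          exact ⟨h, hh', .inr ⟨⟨hB r hr h hh', hh h hh'⟩, hi⟩⟩
        · push Not at hi
          obtain ⟨h, hh'⟩ := r.exists_mem_head
          obtain ⟨a, ha, haM⟩ := hM.2.1 r hr ⟨fun a ha => (hp a ha).resolve_right fun h2 => by
              have := hpos r hr h hh' a ha
              have := hi h hh'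
              have := h2.2
              omega, fun a ha haM => hn a ha (.inl haM)⟩
          exact ⟨a, ha, .inl haM⟩)
    (fun M hM N hN a ha => by
      by_cases haR : a ∈ R
      · exact .inl (hM.2.2.symm ▸ (hN.2.2 ▸ ⟨ha, haR⟩ : a ∈ X) : a ∈ M ∩ R).1
      · exact .inr ⟨hN.1 ha, haR⟩) k
  refine ⟨M, ⟨isModel_reduct_iff.2 fun r hr hn hp => hMmod r hr ⟨hp, hn⟩, fun N hNM hN => ?_⟩, hMR⟩
  by_contra hne
  have hN := isModel_reduct_iff.1 hN
  have hNR : N ∩ R = X := by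
    refine hX.2 _ (hMR ▸ Set.inter_subset_inter_left R hNM) (isModel_reduct_iff.2 ?_)
    rintro r ⟨hr, hh⟩ hn hp
    have hat := hR r hr hh
    obtain ⟨a, ha, haN⟩ := hN r hr (fun a ha haM => hn a ha
      (hMR ▸ ⟨haM, hat a (Rule.mem_atoms.2 (.inr (.inr ha)))⟩)) fun a ha => (hp a ha).1
    exact ⟨a, ha, haN, hat a (Rule.mem_atoms.2 (.inl ha))⟩
  have hex : ∃ i, ∃ c ∈ M, c ∉ N ∧ level c = i := by
    by_contra h
    push Not at h
    exact hne (hNM.antisymm fun c hc => by_contra fun hcN => h _ c hc hcN rfl)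
  classical
  -- `c` is an atom of lowest level in `M \ N`; below that level `M` and `N` agree.
  obtain ⟨c, hcM, hcN, hc⟩ := Nat.find_spec hex
  have hlow : ∀ a ∈ M, a ∉ N → level c ≤ level a := fun a ha haN =>
    hc ▸ Nat.find_min' hex ⟨a, ha, haN, rfl⟩
  have hN'R := hagree N {a ∈ B \ R | level c < level a} hNR fun a ha => ha.1
  -- Filling up the levels above `c` satisfies the rules with a head atom there. For the others,
  -- negative body atoms lie strictly below the level of `c`, where `M` and `N` agree, so the reduct
  -- by `M` keeps the rule. The resulting member of `F` omits `c`, against the minimality of `M`.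
  have hN'F : N ∪ {a ∈ B \ R | level c < level a} ∈ F := by
    refine ⟨Set.union_subset (hNM.trans hMB) fun a ha => ha.1.1, fun r hr => ?_, hN'R⟩
    by_cases hh : ∃ h ∈ r.head, h ∈ R
    · exact hbot _ hN'R r hr hh
    rintro ⟨hp, hn⟩
    push Not at hh
    obtain ⟨h, hh'⟩ := r.exists_mem_head
    by_cases hi : level c < level h
    · exact ⟨h, hh', .inr ⟨⟨hB r hr h hh', hh h hh'⟩, hi⟩⟩
    obtain ⟨a, ha, haN⟩ := hN r hr (fun a ha haM => by
        have h1 : a ∉ N := fun h2 => hn a ha (.inl h2)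
        have := hlow a haM h1
        have := hneg r hr h hh' a ha
        omega) fun a ha => (hp a ha).resolve_right fun h2 => by
          have := hpos r hr h hh' a ha
          have := h2.2
          omega
    exact ⟨a, ha, .inl haN⟩
  rcases hmin (level c) (hk c (hMB hcM)) _ hN'F
    (fun a ha => ⟨fun h => h.elim (fun h => hNM h) fun h => absurd h.2 (by omega),
      fun h => .inl (by_contra fun h2 => absurd (hlow a h h2) (by omega))⟩)
    (fun a ha h => h.elim (fun h => hNM h) fun h => absurd h.2 (by omega)) c rfl hcM with h | h
  · exact hcN h
  · exact lt_irrefl _ h.2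

/-! ### Stratified programs -/

/-- `p` reaches `q` along a path of dependencies that contains a negative one. -/
def ReachesNeg (P : Program) (p q : ℕ × ℕ) : Prop :=
  ∃ p' q', Relation.ReflTransGen (Depends P) p p' ∧ DependsNeg P p' q' ∧
    Relation.ReflTransGen (Depends P) q' q

/-- The predicates of negative body atoms. -/
def negPreds (P : Program) : Finset (ℕ × ℕ) :=
  (P.flatMap fun r => r.negBody.map Atom.pred).toFinset

open Classical in
/-- The level of a predicate: the number of predicates of negative body atoms that it reaches
through a negative dependency. -/
noncomputable def predLevel (P : Program) (p : ℕ × ℕ) : ℕ :=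
  ((negPreds P).filter (ReachesNeg P p)).card

theorem predLevel_lt (P : Program) (p : ℕ × ℕ) : predLevel P p < (negPreds P).card + 1 := by
  classical
  exact Nat.lt_succ_of_le (Finset.card_filter_le _ _)

theorem predLevel_le_of_depends {P : Program} {p q : ℕ × ℕ} (h : Depends P p q) :
    predLevel P q ≤ predLevel P p := by
  classical
  refine Finset.card_le_card fun x hx => ?_
  simp only [Finset.mem_filter] at hx ⊢
  obtain ⟨hx, p', q', h1, h2, h3⟩ := hx
  exact ⟨hx, p', q', .head h h1, h2, h3⟩

/-- `q` itself is counted for `p` but not for `q`: otherwise a cycle would contain a negative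
dependency. -/
theorem predLevel_lt_of_dependsNeg {P : Program} (hP : Stratified P) {p q : ℕ × ℕ}
    (h : DependsNeg P p q) : predLevel P q < predLevel P p := by
  classical
  refine Finset.card_lt_card ⟨fun x hx => ?_, fun hsub => ?_⟩
  · simp only [Finset.mem_filter] at hx ⊢
    obtain ⟨hx, p', q', h1, h2, h3⟩ := hx
    exact ⟨hx, p', q', .head (.inr h) h1, h2, h3⟩
  · have hq : q ∈ (negPreds P).filter (ReachesNeg P p) := by
      refine Finset.mem_filter.2 ⟨?_, p, q, .refl, h, .refl⟩
      obtain ⟨r, hr, -, b, hb, hbq⟩ := h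
      simp only [negPreds, List.mem_toFinset, List.mem_flatMap, List.mem_map]
      exact ⟨r, hr, b, hb, hbq⟩
    obtain ⟨-, p', q', h1, h2, h3⟩ := Finset.mem_filter.1 (hsub hq)
    exact hP ⟨p', q', h2, h3.trans h1⟩

/-! ### Ground terms and substitutions -/

theorem Term.ind {C : Term → Prop} (hv : ∀ x, C (.var x))
    (hf : ∀ f ts, (∀ t ∈ ts, C t) → C (.fn f ts)) : ∀ t, C t
  | .var x => hv x
  | .fn f ts => hf f ts fun t _ => Term.ind hv hf t

/-- Replaces the inductive predicate by a finite check on symbols, which is visibly primitive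
recursive. -/
theorem inUniverse_iff {P : Program} (t : Term) :
    InUniverse P t ↔ t.vars = [] ∧ ∀ f ∈ t.functors, f ∈ functors P := by
  constructor
  · intro h
    induction h with
    | fn f ts hf hts ih =>
      simp only [Term.vars, Term.functors, List.flatMap_eq_nil_iff, List.mem_cons,
        List.mem_flatMap]
      refine ⟨fun t ht => (ih t ht).1, ?_⟩
      rintro g (rfl | ⟨t, ht, hg⟩)
      · exact hf
      · exact (ih t ht).2 g hg
  · induction t using Term.ind with
    | hv x => simp [Term.vars]
    | hf f ts ih =>
      simp only [Term.vars, Term.functors, List.flatMap_eq_nil_iff, List.mem_cons,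
        List.mem_flatMap]
      rintro ⟨h1, h2⟩
      exact .fn f ts (h2 _ (.inl rfl)) fun t ht => ih t ht ⟨h1 t ht, fun g hg =>
        h2 g (.inr ⟨t, ht, hg⟩)⟩

theorem InUniverse.subst {P : Program} {σ : ℕ → Term} (t : Term)
    (hf : ∀ f ∈ t.functors, f ∈ functors P) (hσ : ∀ x ∈ t.vars, InUniverse P (σ x)) :
    InUniverse P (t.subst σ) := by
  induction t using Term.ind with
  | hv x => simpa [Term.subst] using hσ x (by simp [Term.vars])
  | hf f ts ih =>
    simp only [Term.vars, Term.functors, List.mem_cons, List.mem_flatMap] at hf hσ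
    rw [Term.subst]
    refine .fn _ _ (by simpa using hf _ (.inl rfl)) ?_
    simp only [List.mem_map, forall_exists_index, and_imp, forall_apply_eq_imp_iff₂]
    exact fun t ht => ih t ht (fun g hg => hf g (.inr ⟨t, ht, hg⟩)) fun x hx => hσ x ⟨t, ht, hx⟩

theorem Term.subst_congr {σ τ : ℕ → Term} (t : Term) (h : ∀ x ∈ t.vars, σ x = τ x) :
    t.subst σ = t.subst τ := by
  induction t using Term.ind with
  | hv x => simpa [Term.subst] using h x (by simp [Term.vars])
  | hf f ts ih =>
    simp only [Term.vars, List.mem_flatMap] at h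
    simp only [Term.subst, Term.fn.injEq, true_and, List.map_inj_left]
    exact fun t ht => ih t ht fun x hx => h x ⟨t, ht, hx⟩

theorem Atom.subst_congr {σ τ : ℕ → Term} (a : Atom) (h : ∀ x ∈ a.vars, σ x = τ x) :
    a.subst σ = a.subst τ := by
  simp only [Atom.subst, Atom.mk.injEq, true_and, List.map_inj_left]
  exact fun t ht => t.subst_congr fun x hx => h x (List.mem_flatMap.2 ⟨t, ht, hx⟩)

theorem Rule.mem_vars {r : Rule} {a : Atom} (ha : a ∈ r.atoms) {x : ℕ} (hx : x ∈ a.vars) :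
    x ∈ r.vars :=
  List.mem_flatMap.2 ⟨a, ha, hx⟩

theorem Rule.subst_congr {σ τ : ℕ → Term} (r : Rule) (h : ∀ x ∈ r.vars, σ x = τ x) :
    r.subst σ = r.subst τ := by
  simp only [Rule.subst, Rule.mk.injEq, List.map_inj_left]
  refine ⟨fun a ha => ?_, fun a ha => ?_, fun a ha => ?_⟩ <;>
  · exact a.subst_congr fun x hx => h x (Rule.mem_vars (by simp [Rule.mem_atoms, ha]) hx)

theorem Rule.atoms_subst (σ : ℕ → Term) (r : Rule) :
    (r.subst σ).atoms = r.atoms.map (Atom.subst σ) := by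
  simp [Rule.atoms, Rule.subst]

theorem Atom.pred_subst (σ : ℕ → Term) (a : Atom) : (a.subst σ).pred = a.pred := by
  simp [Atom.pred, Atom.subst]

theorem mem_base_of_mem_ground {P : Program} {r : Rule} (hr : r ∈ ground P) {a : Atom}
    (ha : a ∈ r.atoms) : a ∈ base P := by
  obtain ⟨r, hrP, σ, hσ, rfl⟩ := hr
  rw [Rule.atoms_subst, List.mem_map] at ha
  obtain ⟨a, ha, rfl⟩ := ha
  refine ⟨⟨r, hrP, a, ha, (Atom.pred_subst σ a).symm⟩, ?_⟩
  simp only [Atom.subst, List.mem_map, forall_exists_index, and_imp, forall_apply_eq_imp_iff₂]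
  exact fun t ht => .subst t (fun f hf => ⟨r, hrP, a, ha, List.mem_flatMap.2 ⟨t, ht, hf⟩⟩)
    fun x hx => hσ x (Rule.mem_vars ha (List.mem_flatMap.2 ⟨t, ht, hx⟩))

/-! ### Stable models and closed sets of atoms -/

theorem isStableModel_iff {P : Program} {M : Set Atom} :
    IsStableModel P M ↔ IsAnswerSet (ground P) M := by
  refine ⟨fun h => h.2, fun h => ⟨h.subset fun r hr a ha => ?_, h⟩⟩
  exact mem_base_of_mem_ground hr (Rule.mem_atoms.2 (.inl ha))

theorem exists_isStableModel_inter_eq_iff {P : Program} (hP : Stratified P) {R : Set Atom}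
    (hR : ClosedUnder (ground P) R) {X : Set Atom} :
    (∃ M, IsStableModel P M ∧ M ∩ R = X) ↔ IsAnswerSet (bottom (ground P) R) X := by
  simp only [isStableModel_iff]
  constructor
  · rintro ⟨M, hM, rfl⟩
    exact hM.inter hR
  · refine IsAnswerSet.exists_extension (B := base P) (level := fun a => predLevel P a.pred)
      (k := (negPreds P).card + 1) hR
      (fun r hr h hh => mem_base_of_mem_ground hr (Rule.mem_atoms.2 (.inl hh)))
      ?_ ?_ fun a _ => predLevel_lt P a.pred
    all_goals
      rintro _ ⟨r, hr, σ, -, rfl⟩ h hh b hb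
      simp only [Rule.subst, List.mem_map] at hh hb
      obtain ⟨h, hh, rfl⟩ := hh
      obtain ⟨b, hb, rfl⟩ := hb
      simp only [Atom.pred_subst]
    · exact predLevel_le_of_depends (.inl ⟨r, hr, ⟨h, hh, rfl⟩, b, hb, rfl⟩)
    · exact predLevel_lt_of_dependsNeg hP ⟨r, hr, ⟨h, hh, rfl⟩, b, hb, rfl⟩

theorem cautiouslyEntails_iff {P : Program} (hP : Stratified P) {R : Set Atom}
    (hR : ClosedUnder (ground P) R) {Q : Atom} (hQ : Q ∈ R) :
    CautiouslyEntails P Q ↔ ∀ X, IsAnswerSet (bottom (ground P) R) X → Q ∈ X := by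
  simp only [← exists_isStableModel_inter_eq_iff hP hR]
  constructor
  · rintro h _ ⟨M, hM, rfl⟩
    exact ⟨h M hM, hQ⟩
  · exact fun h M hM => (h _ ⟨M, hM, rfl⟩).1

theorem bravelyEntails_iff {P : Program} (hP : Stratified P) {R : Set Atom}
    (hR : ClosedUnder (ground P) R) {Q : Atom} (hQ : Q ∈ R) :
    BravelyEntails P Q ↔ ∃ X, IsAnswerSet (bottom (ground P) R) X ∧ Q ∈ X := by
  simp only [← exists_isStableModel_inter_eq_iff hP hR]
  constructor
  · rintro ⟨M, hM, h⟩
    exact ⟨_, ⟨M, hM, rfl⟩, h, hQ⟩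
  · rintro ⟨_, ⟨M, hM, rfl⟩, h⟩
    exact ⟨M, hM, h.1⟩

theorem closedUnder_relevant (P : Program) (Q : Atom) :
    ClosedUnder (ground P) {a | Relevant P Q a} := by
  rintro r hr ⟨h, hh, hrel⟩ a ha
  exact Relevant.step r hr h hh hrel a ha

/-! ### Bounded instances -/

/-- All lists of length at most `n` with entries in `T`. -/
def lists {α : Type*} (T : List α) : ℕ → List (List α)
  | 0 => [[]]
  | n + 1 => [] :: T.flatMap fun t => (lists T n).map (t :: ·)

theorem mem_lists {α : Type*} {T : List α} {n : ℕ} {l : List α} :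
    l ∈ lists T n ↔ l.length ≤ n ∧ ∀ x ∈ l, x ∈ T := by
  induction n generalizing l with
  | zero =>
    simp only [lists, List.mem_singleton, Nat.le_zero, List.length_eq_zero_iff]
    exact ⟨by rintro rfl; simp, fun h => h.1⟩
  | succ n ih =>
    cases l with
    | nil => simp [lists]
    | cons a l =>
      simp only [lists, List.mem_cons, reduceCtorEq, List.mem_flatMap, List.mem_map,
        List.cons.injEq, false_or, List.length_cons, Nat.add_le_add_iff_right,
        forall_eq_or_imp]
      constructor
      · rintro ⟨t, ht, l', hl', rfl, rfl⟩
        exact ⟨(ih.1 hl').1, ht, (ih.1 hl').2⟩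
      · rintro ⟨h1, h2, h3⟩
        exact ⟨a, h2, l, ih.2 ⟨h1, h3⟩, rfl, rfl⟩

/-- The terms with code less than `K`. -/
def terms (K : ℕ) : List Term := (List.range K).map Term.ofNat

theorem mem_terms {K : ℕ} {t : Term} : t ∈ terms K ↔ t.toNat < K := by
  simp only [terms, List.mem_map, List.mem_range]
  constructor
  · rintro ⟨n, hn, rfl⟩
    rwa [Term.toNat_ofNat]
  · exact fun h => ⟨_, h, Term.ofNat_toNat t⟩

/-- The substitution presented by a list of terms. -/
def listSubst (l : List Term) (x : ℕ) : Term := l.getD x (.var 0)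

/-- The ground instances of rules of `P` under substitutions presented by lists of length at most
`K` of terms with code less than `K`. -/
def instancesBelow (P : Program) (K : ℕ) : Set Rule :=
  {r' | ∃ r ∈ P, ∃ l ∈ lists (terms K) K, (∀ x ∈ r.vars, InUniverse P (listSubst l x)) ∧
    r' = r.subst (listSubst l)}

theorem instancesBelow_subset_ground (P : Program) (K : ℕ) : instancesBelow P K ⊆ ground P := by
  rintro _ ⟨r, hr, l, -, hl, rfl⟩
  exact ⟨r, hr, _, hl, rfl⟩

theorem subst_mem_instancesBelow {P : Program} {K : ℕ} {r : Rule} (hr : r ∈ P)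
    (hK : ∀ x ∈ r.vars, x < K) {σ : ℕ → Term} (hσ : ∀ x ∈ r.vars, InUniverse P (σ x))
    (hσK : ∀ x ∈ r.vars, (σ x).toNat < K) : r.subst σ ∈ instancesBelow P K := by
  -- The padding term `var 0` has code 0, so it is below `K` whenever the list has an entry.
  let l : List Term := (List.range K).map fun x => if x ∈ r.vars then σ x else .var 0
  have hl : ∀ x ∈ r.vars, σ x = listSubst l x := by
    intro x hx
    simp [l, listSubst, List.getD, hK x hx, hx]
  refine ⟨r, hr, l, mem_lists.2 ⟨by simp [l], ?_⟩, fun x hx => hl x hx ▸ hσ x hx,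
    r.subst_congr hl⟩
  simp only [l, List.mem_map, List.mem_range, forall_exists_index, and_imp,
    forall_apply_eq_imp_iff₂, mem_terms]
  intro x hx
  split
  · exact hσK x ‹_›
  · simp only [Term.toNat]
    omega

theorem Term.toNat_lt_toNat_fn {t : Term} {ts : List Term} (f : ℕ) (h : t ∈ ts) :
    t.toNat < (Term.fn f ts).toNat := by
  have h1 : t.toNat < Encodable.encode (ts.map toNat) := by
    induction ts with
    | nil => simp at h
    | cons s ts ih =>
      simp only [List.map_cons, Encodable.encode_list_cons, Encodable.encode_nat]
      rcases List.mem_cons.1 h with rfl | h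
      · exact Nat.lt_succ_of_le (Nat.left_le_pair _ _)
      · exact (ih h).trans_le ((Nat.right_le_pair _ _).trans (Nat.le_succ _))
  have h2 := Nat.right_le_pair f (Encodable.encode (ts.map toNat))
  rw [toNat]
  omega

theorem Term.toNat_le_toNat_subst {σ : ℕ → Term} {x : ℕ} (t : Term) (hx : x ∈ t.vars) :
    (σ x).toNat ≤ (t.subst σ).toNat := by
  induction t using Term.ind with
  | hv y =>
    obtain rfl : x = y := by simpa [vars] using hx
    simp [subst]
  | hf f ts ih =>
    simp only [vars, List.mem_flatMap] at hx
    obtain ⟨t, ht, hx⟩ := hx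
    rw [subst]
    exact (ih t ht hx).trans (toNat_lt_toNat_fn f (List.mem_map_of_mem ht)).le

theorem Atom.exists_arg_toNat_le {σ : ℕ → Term} {x : ℕ} {a : Atom} (hx : x ∈ a.vars) :
    ∃ t ∈ (a.subst σ).args, (σ x).toNat ≤ t.toNat := by
  obtain ⟨t, ht, hx⟩ := List.mem_flatMap.1 hx
  exact ⟨t.subst σ, List.mem_map_of_mem ht, t.toNat_le_toNat_subst hx⟩

/-- Either some element of the universe with code less than `K` exceeds all arguments of atoms
in `R`, or all elements of the universe are constants with code less than `K`, or the universe
is empty as there are no constants. -/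
def Dominates (P : Program) (K : ℕ) (R : List Atom) : Prop :=
  (∃ u ∈ terms K, (u.vars = [] ∧ ∀ f ∈ u.functors, ∃ r ∈ P, ∃ a ∈ r.atoms, f ∈ a.functors) ∧
    ∀ a ∈ R, ∀ t ∈ a.args, t.toNat < u.toNat) ∨
  (∀ r ∈ P, ∀ a ∈ r.atoms, ∀ f ∈ a.functors, f.2 = 0 ∧ (Term.fn f.1 []).toNat < K) ∨
  ∀ r ∈ P, ∀ a ∈ r.atoms, ∀ f ∈ a.functors, f.2 ≠ 0

theorem Dominates.cases {P : Program} {K : ℕ} {R : List Atom} (h : Dominates P K R) :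
    (∃ u, u.toNat < K ∧ InUniverse P u ∧ ∀ a ∈ R, ∀ t ∈ a.args, t.toNat < u.toNat) ∨
      ∀ t, InUniverse P t → t.toNat < K := by
  rcases h with ⟨u, hu, h1, h2⟩ | h | h
  · exact .inl ⟨u, mem_terms.1 hu, (inUniverse_iff u).2 h1, h2⟩
  · right
    rintro _ ⟨f, ts, ⟨r, hr, a, ha, hf⟩, -⟩
    obtain ⟨h1, h2⟩ := h r hr a ha _ hf
    obtain rfl : ts = [] := by simpa using h1
    exact h2
  · right
    intro t ht
    exfalso
    induction ht with
    | fn f ts hf hts ih =>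
      obtain ⟨r, hr, a, ha, hf⟩ := hf
      obtain ⟨t, ht⟩ := List.exists_mem_of_length_pos (Nat.pos_of_ne_zero (h r hr a ha _ hf))
      exact ih t ht

/-- `K` and `R` witness that the set `R`, which contains `Q`, is closed under the ground
instances of `P`. -/
def IsCertificate (P : Program) (Q : Atom) (K : ℕ) (R : List Atom) : Prop :=
  Q ∈ R ∧ (∀ r ∈ P, ∀ x ∈ r.vars, x < K) ∧ Dominates P K R ∧
    ClosedUnder (instancesBelow P K) {a | a ∈ R}

/-- When the universe is not bounded by `K`, cut a substitution `σ` down to `τ` by sending every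
value with code at least `K` to `u`. A head in `R` is unaffected, as its arguments are smaller than
`u`. The bounded check puts the `τ`-instance into `R`, so `u` was never substituted and `τ` agrees
with `σ` on the rule's atoms. -/
theorem IsCertificate.closedUnder_ground {P : Program} {Q : Atom} {K : ℕ} {R : List Atom}
    (h : IsCertificate P Q K R) : ClosedUnder (ground P) {a | a ∈ R} := by
  obtain ⟨-, hK, hD, hR⟩ := h
  rcases hD.cases with ⟨u, huK, hu, huR⟩ | hU
  · rintro _ ⟨r, hr, σ, hσ, rfl⟩ ⟨h, hh, hhR⟩ a ha
    simp only [Rule.subst, List.mem_map] at hh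
    obtain ⟨h, hh, rfl⟩ := hh
    rw [Rule.atoms_subst, List.mem_map] at ha
    obtain ⟨a, ha, rfl⟩ := ha
    let τ : ℕ → Term := fun x => if (σ x).toNat < K then σ x else u
    have hsmall : ∀ (b : Atom) (ρ : ℕ → Term), b.subst ρ ∈ R → ∀ x ∈ b.vars,
        (ρ x).toNat < u.toNat := by
      intro b ρ hb x hx
      obtain ⟨t, ht, hxt⟩ := Atom.exists_arg_toNat_le (σ := ρ) hx
      exact hxt.trans_lt (huR _ hb t ht)
    have hστ : ∀ x, (τ x).toNat < u.toNat → σ x = τ x := by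
      intro x hx
      simp only [τ] at hx ⊢
      split_ifs at hx ⊢
      · rfl
      · exact absurd hx (lt_irrefl _)
    have hh' : h.subst σ = h.subst τ := h.subst_congr fun x hx => by
      have : (σ x).toNat < K := (hsmall h σ hhR x hx).trans huK
      simp [τ, this]
    have hmem := hR (r.subst τ) (subst_mem_instancesBelow hr (hK r hr)
      (fun x hx => by simp only [τ]; split_ifs <;> [exact hσ x hx; exact hu])
      (fun x _ => by simp only [τ]; split_ifs <;> assumption))
      ⟨h.subst τ, List.mem_map_of_mem hh, hh' ▸ hhR⟩ (a.subst τ)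
      (by rw [Rule.atoms_subst]; exact List.mem_map_of_mem ha)
    rwa [a.subst_congr fun x hx => hστ x (hsmall a τ hmem x hx)]
  · rintro _ ⟨r, hr, σ, hσ, rfl⟩
    exact hR _ (subst_mem_instancesBelow hr (hK r hr) hσ fun x hx => hU _ (hσ x hx))

/-- By closedness all atoms of a rule with a head in `R` lie in `R`, which bounds the values of all
its variables. -/
theorem IsCertificate.bottom_ground_eq {P : Program} {Q : Atom} {K : ℕ} {R : List Atom}
    (h : IsCertificate P Q K R) :
    bottom (ground P) {a | a ∈ R} = bottom (instancesBelow P K) {a | a ∈ R} := by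
  refine Set.Subset.antisymm ?_ fun r hr => ⟨instancesBelow_subset_ground P K hr.1, hr.2⟩
  rintro _ ⟨hg, hh⟩
  have hat := h.closedUnder_ground _ hg hh
  obtain ⟨r, hr, σ, hσ, rfl⟩ := hg
  refine ⟨subst_mem_instancesBelow hr (h.2.1 r hr) hσ fun x hx => ?_, hh⟩
  rcases h.2.2.1.cases with ⟨u, huK, hu, huR⟩ | hU
  · obtain ⟨a, ha, hx⟩ := List.mem_flatMap.1 hx
    obtain ⟨t, ht, hxt⟩ := Atom.exists_arg_toNat_le (σ := σ) hx
    exact (hxt.trans_lt (huR _ (hat (a.subst σ)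
      (by rw [Rule.atoms_subst]; exact List.mem_map_of_mem ha)) t ht)).trans huK
  · exact hU _ (hσ x hx)

theorem exists_forall_mem_lt (l : List ℕ) : ∃ N, ∀ x ∈ l, x < N := by
  refine ⟨l.sum + 1, fun x hx => Nat.lt_succ_of_le (List.le_sum_of_mem hx)⟩

/-- Start from a constant and repeatedly apply `f` to copies of the last term; each nesting raises
the code. -/
theorem exists_inUniverse_gt {P : Program} {c : ℕ × ℕ} (hc : c ∈ functors P) (hc0 : c.2 = 0)
    {f : ℕ × ℕ} (hf : f ∈ functors P) (hf0 : f.2 ≠ 0) (N : ℕ) :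
    ∃ u, InUniverse P u ∧ N ≤ u.toNat := by
  obtain ⟨c, _⟩ := c
  obtain ⟨f, k⟩ := f
  subst hc0
  induction N with
  | zero => exact ⟨.fn c [], .fn c [] hc (by simp), Nat.zero_le _⟩
  | succ N ih =>
    obtain ⟨u, hu, hN⟩ := ih
    refine ⟨.fn f (List.replicate k u), .fn _ _ (by simpa using hf) ?_, ?_⟩
    · exact fun t ht => List.eq_of_mem_replicate ht ▸ hu
    · exact Nat.succ_le_of_lt (hN.trans_lt
        (Term.toNat_lt_toNat_fn f (List.mem_replicate.2 ⟨hf0, rfl⟩)))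

theorem exists_isCertificate {P : Program} {Q : Atom} (h : FinitelyRecursive P Q) :
    ∃ K R, IsCertificate P Q K R := by
  classical
  let R : List Atom := h.toFinset.toList
  have hR : {a | a ∈ R} = {a | Relevant P Q a} := by
    ext a
    exact Finset.mem_toList.trans h.mem_toFinset
  obtain ⟨K₁, hK₁⟩ := exists_forall_mem_lt (P.flatMap Rule.vars)
  have hvars : ∀ r ∈ P, ∀ x ∈ r.vars, x < K₁ := fun r hr x hx =>
    hK₁ x (List.mem_flatMap.2 ⟨r, hr, hx⟩)
  -- `Dominates` persists as `K` grows, so it can be combined with the bound on rule variables.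
  suffices hD : ∃ K₂, ∀ K, K₂ ≤ K → Dominates P K R by
    obtain ⟨K₂, hK₂⟩ := hD
    refine ⟨max K₁ K₂, R, ?_, fun r hr x hx => (hvars r hr x hx).trans_le (le_max_left _ _),
      hK₂ _ (le_max_right _ _), ?_⟩
    · exact (Set.ext_iff.1 hR Q).2 Relevant.query
    · rw [hR]
      exact fun r hr => closedUnder_relevant P Q r (instancesBelow_subset_ground P _ hr)
  by_cases hc : ∃ c ∈ functors P, c.2 = 0
  · by_cases hf : ∃ f ∈ functors P, f.2 ≠ 0
    · obtain ⟨c, hc, hc0⟩ := hc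
      obtain ⟨f, hf, hf0⟩ := hf
      obtain ⟨N, hN⟩ := exists_forall_mem_lt ((R.flatMap Atom.args).map Term.toNat)
      obtain ⟨u, hu, hNu⟩ := exists_inUniverse_gt hc hc0 hf hf0 N
      refine ⟨u.toNat + 1, fun K hK => .inl ⟨u, mem_terms.2 hK, (inUniverse_iff u).1 hu,
        fun a ha t ht => (hN _ (List.mem_map_of_mem ?_)).trans_le hNu⟩⟩
      exact List.mem_flatMap.2 ⟨a, ha, ht⟩
    · push Not at hf
      obtain ⟨N, hN⟩ := exists_forall_mem_lt
        ((P.flatMap fun r => r.atoms.flatMap Atom.functors).map fun f => (Term.fn f.1 []).toNat)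
      refine ⟨N, fun K hK => .inr (.inl fun r hr a ha f hfa => ⟨hf f ⟨r, hr, a, ha, hfa⟩,
        (hN _ (List.mem_map.2 ⟨f, ?_, rfl⟩)).trans_le hK⟩)⟩
      exact List.mem_flatMap.2 ⟨r, hr, List.mem_flatMap.2 ⟨a, ha, hfa⟩⟩
  · push Not at hc
    exact ⟨0, fun K _ => .inr (.inr fun r hr a ha f hf => hc f ⟨r, hr, a, ha, hf⟩)⟩

/-! ### Deciding entailment from a certificate -/

/-- If `r` has a head atom in `R`, then `N` satisfies its reduct with respect to `M`. -/
def SatisfiesReduct (R M N : List Atom) (r : Rule) : Prop :=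
  (∃ h ∈ r.head, h ∈ R) → (∀ a ∈ r.negBody, a ∉ M) → (∀ a ∈ r.posBody, a ∈ N) →
    ∃ a ∈ r.head, a ∈ N

/-- `X` lists an answer set of the bounded instances of `P` with a head atom in `R`. -/
def IsListAnswerSet (P : Program) (K : ℕ) (R X : List Atom) : Prop :=
  (∀ r ∈ instancesBelow P K, SatisfiesReduct R X X r) ∧
    ∀ Y ∈ lists X X.length, (∀ r ∈ instancesBelow P K, SatisfiesReduct R X Y r) →
      ∀ a ∈ X, a ∈ Y

theorem isModel_reduct_bottom_iff {S : Set Rule} {R M N : List Atom} :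
    IsModel {a | a ∈ N} (reduct (bottom S {a | a ∈ R}) {a | a ∈ M}) ↔
      ∀ r ∈ S, SatisfiesReduct R M N r := by
  rw [isModel_reduct_iff]
  exact ⟨fun h r hr hh => h r ⟨hr, hh⟩, fun h r hr => h r hr.1 hr.2⟩

theorem exists_mem_lists_of_subset {X : List Atom} {Y : Set Atom} (h : Y ⊆ {a | a ∈ X}) :
    ∃ l ∈ lists X X.length, {a | a ∈ l} = Y := by
  classical
  refine ⟨X.filter (· ∈ Y), mem_lists.2 ⟨List.length_filter_le _ _, fun a ha =>
    (List.mem_filter.1 ha).1⟩, ?_⟩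
  ext a
  simpa using fun ha => h ha

theorem isListAnswerSet_iff {P : Program} {K : ℕ} {R X : List Atom} :
    IsListAnswerSet P K R X ↔
      IsAnswerSet (bottom (instancesBelow P K) {a | a ∈ R}) {a | a ∈ X} := by
  simp only [IsListAnswerSet, IsAnswerSet, ← isModel_reduct_bottom_iff]
  refine and_congr_right fun _ => ⟨fun h Y hY hm => ?_, fun h Y hY hm a ha => ?_⟩
  · obtain ⟨l, hl, rfl⟩ := exists_mem_lists_of_subset hY
    exact hY.antisymm (h l hl hm)
  · have := h {a | a ∈ Y} (fun b hb => (mem_lists.1 hY).2 b hb) hm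
    exact this.symm.subset ha

/-- Answer sets of the bottom are subsets of `R`, hence are presented by sublists of `R`. -/
theorem IsCertificate.forall_isAnswerSet_iff {P : Program} {Q : Atom} {K : ℕ} {R : List Atom}
    (h : IsCertificate P Q K R) (p : Set Atom → Prop) :
    (∀ X, IsAnswerSet (bottom (ground P) {a | a ∈ R}) X → p X) ↔
      ∀ X ∈ lists R R.length, IsListAnswerSet P K R X → p {a | a ∈ X} := by
  simp only [isListAnswerSet_iff, h.bottom_ground_eq]
  refine ⟨fun h X _ hX => h _ hX, fun h' X hX => ?_⟩
  obtain ⟨l, hl, rfl⟩ := exists_mem_lists_of_subset (X := R) (Y := X) (by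
    rw [← h.bottom_ground_eq] at hX
    exact hX.subset fun r hr a ha =>
      h.closedUnder_ground r hr.1 hr.2 a (Rule.mem_atoms.2 (.inl ha)))
  exact h' l hl hX

theorem IsCertificate.cautiouslyEntails_iff {P : Program} {Q : Atom} {K : ℕ} {R : List Atom}
    (h : IsCertificate P Q K R) (hP : Stratified P) :
    CautiouslyEntails P Q ↔ ∀ X ∈ lists R R.length, IsListAnswerSet P K R X → Q ∈ X := by
  rw [ASP.cautiouslyEntails_iff hP h.closedUnder_ground h.1]
  exact h.forall_isAnswerSet_iff (Q ∈ ·)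

theorem IsCertificate.bravelyEntails_iff {P : Program} {Q : Atom} {K : ℕ} {R : List Atom}
    (h : IsCertificate P Q K R) (hP : Stratified P) :
    BravelyEntails P Q ↔ ¬ ∀ X ∈ lists R R.length, IsListAnswerSet P K R X → Q ∉ X := by
  rw [ASP.bravelyEntails_iff hP h.closedUnder_ground h.1]
  refine Iff.trans ?_ (not_congr (h.forall_isAnswerSet_iff (Q ∉ ·)))
  push Not
  rfl

end ASP

/-! ### Primitive recursive predicates -/

section PrimrecPred

variable {α β : Type*} [Primcodable α] [Primcodable β]

theorem PrimrecPred.imp {p q : α → Prop} (hp : PrimrecPred p) (hq : PrimrecPred q) :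
    PrimrecPred fun a => p a → q a := by
  classical
  exact (hp.not.or hq).of_eq fun a => imp_iff_not_or.symm

theorem PrimrecPred.forall_mem {f : α → List β} {p : α → β → Prop} (hf : Primrec f)
    (hp : PrimrecRel p) : PrimrecPred fun a => ∀ b ∈ f a, p a b :=
  (PrimrecRel.forall_mem_list hp.swap).comp hf Primrec.id

theorem PrimrecPred.exists_mem {f : α → List β} {p : α → β → Prop} (hf : Primrec f)
    (hp : PrimrecRel p) : PrimrecPred fun a => ∃ b ∈ f a, p a b :=
  (PrimrecRel.exists_mem_list hp.swap).comp hf Primrec.id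

theorem PrimrecPred.mem {f : α → List β} {g : α → β} (hf : Primrec f) (hg : Primrec g) :
    PrimrecPred fun a => g a ∈ f a :=
  (PrimrecPred.exists_mem hf (p := fun a b => g a = b)
    (Primrec.eq.comp (hg.comp Primrec.fst) Primrec.snd)).of_eq fun a => by simp

end PrimrecPred

namespace ASP

section Primrec

open Primrec

variable {α β γ : Type*} [Primcodable α] [Primcodable β] [Primcodable γ]

theorem primrec_toNat : Primrec Term.toNat := Primrec.of_equiv (e := Term.equivNat)

theorem primrec_ofNat : Primrec Term.ofNat := Primrec.of_equiv_symm (e := Term.equivNat)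

theorem Term.denumerable_ofNat_list (m : ℕ) :
    Denumerable.ofNat (List ℕ) m = (Term.listOfNat m).map Term.toNat := by
  conv_lhs => rw [← Term.encode_listOfNat m]
  exact Denumerable.ofNat_encode _

/-- A function defined by recursion on terms is primitive recursive. -/
theorem primrec_term_rec {g : α → ℕ → β} {h : α → ℕ × List β → β} {F : α → Term → β}
    (hg : Primrec₂ g) (hh : Primrec₂ h) (hv : ∀ a x, F a (.var x) = g a x)
    (hf : ∀ a f ts, F a (.fn f ts) = h a (f, ts.map (F a))) : Primrec₂ F := by
  have hhalf : Primrec fun q : α × List β => q.2.length / 2 :=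
    Primrec.nat_div.comp (list_length.comp snd) (const 2)
  -- Course-of-values recursion on codes: `L` lists the values at all codes below `n = L.length`,
  -- and the values at the arguments are looked up in it.
  have hstep : Primrec₂ fun (a : α) (L : List β) =>
      if L.length % 2 = 0 then some (g a (L.length / 2))
      else some (h a ((L.length / 2).unpair.1,
        (Denumerable.ofNat (List ℕ) (L.length / 2).unpair.2).filterMap fun m => L[m]?)) := by
    refine Primrec.ite (Primrec.eq.comp
      (Primrec.nat_mod.comp (list_length.comp snd) (const 2)) (const 0)) ?_ ?_
    · exact option_some.comp (hg.comp fst hhalf)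
    · refine option_some.comp (hh.comp fst ((fst.comp (unpair.comp hhalf)).pair ?_))
      exact listFilterMap ((Primrec.ofNat (List ℕ)).comp (snd.comp (unpair.comp hhalf)))
        (list_getElem?.comp (snd.comp fst) snd)
  have hrec : Primrec₂ fun (a : α) (n : ℕ) => F a (Term.ofNat n) := by
    refine nat_strong_rec _ hstep fun a n => ?_
    simp only [List.length_map, List.length_range]
    rw [Term.ofNat.eq_def n]
    split
    · rw [hv]
    · rw [hf, Term.denumerable_ofNat_list, List.filterMap_map]
      congr 3
      have hn := Term.toNat_ofNat n
      rw [Term.ofNat.eq_def n, if_neg ‹_›] at hn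
      refine Eq.trans ?_ (congrFun List.filterMap_eq_map _)
      refine List.filterMap_congr fun t ht => ?_
      -- Arguments have smaller codes than the term, so every lookup succeeds and `filterMap` drops
      -- nothing.
      have hlt : t.toNat < n := hn ▸ Term.toNat_lt_toNat_fn _ ht
      simp [hlt, Term.ofNat_toNat]
  exact (hrec.comp fst (primrec_toNat.comp snd)).of_eq fun q => by rw [Term.ofNat_toNat]

theorem primrec_listSubst : Primrec₂ listSubst := list_getD _

theorem primrec_fn : Primrec₂ Term.fn :=
  (primrec_ofNat.comp (succ.comp (nat_mul.comp (const 2) (Primrec₂.natPair.comp fst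
    (Primrec.encode.comp (list_map snd (primrec_toNat.comp snd).to₂)))))).of_eq fun q =>
      Term.equivNat.symm_apply_eq.2 (by simp [Term.equivNat, Term.toNat])

theorem primrec_term_vars : Primrec Term.vars :=
  (primrec_term_rec (α := Unit) (F := fun _ => Term.vars) (g := fun _ x => [x])
    (h := fun _ q => q.2.flatten) (list_cons.comp snd (const []))
    (list_flatten.comp (snd.comp snd)) (fun _ _ => by simp [Term.vars])
    (fun _ _ _ => by simp [Term.vars, List.flatMap])).comp (const ()) Primrec.id

theorem primrec_term_functors : Primrec Term.functors :=
  (primrec_term_rec (α := Unit) (F := fun _ => Term.functors) (g := fun _ _ => [])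
    (h := fun _ q => (q.1, q.2.length) :: q.2.flatten) (const [])
    (list_cons.comp ((fst.comp snd).pair (list_length.comp (snd.comp snd)))
      (list_flatten.comp (snd.comp snd))) (fun _ _ => by simp [Term.functors])
    (fun _ _ _ => by simp [Term.functors, List.flatMap])).comp (const ()) Primrec.id

theorem primrec_term_subst : Primrec₂ fun (l : List Term) t => Term.subst (listSubst l) t :=
  primrec_term_rec (g := listSubst) (h := fun _ q => .fn q.1 q.2) primrec_listSubst
    (primrec_fn.comp (fst.comp snd) (snd.comp snd)) (fun _ _ => by simp [Term.subst])
    (fun _ _ _ => by simp [Term.subst])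

theorem primrec_atom_args : Primrec Atom.args :=
  snd.comp (Primrec.of_equiv (e := Atom.equivProd))

theorem primrec_atom_name : Primrec Atom.name :=
  fst.comp (Primrec.of_equiv (e := Atom.equivProd))

theorem primrec_atom_vars : Primrec Atom.vars :=
  list_flatMap primrec_atom_args (primrec_term_vars.comp snd).to₂

theorem primrec_atom_functors : Primrec Atom.functors :=
  list_flatMap primrec_atom_args (primrec_term_functors.comp snd).to₂

theorem primrec_atom_subst : Primrec₂ fun (l : List Term) a => Atom.subst (listSubst l) a :=
  (Primrec.of_equiv_iff Atom.equivProd).1 <|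
    (primrec_atom_name.comp snd).pair
      (list_map (primrec_atom_args.comp snd) (primrec_term_subst.comp (fst.comp fst) snd))

theorem primrec_rule_posBody : Primrec Rule.posBody :=
  fst.comp (snd.comp (Primrec.of_equiv (e := Rule.equivProd)))

theorem primrec_rule_negBody : Primrec Rule.negBody :=
  snd.comp (snd.comp (Primrec.of_equiv (e := Rule.equivProd)))

theorem primrec_rule_head : Primrec Rule.head :=
  (list_cons.comp (fst.comp (fst.comp (Primrec.of_equiv (e := Rule.equivProd))))
    (snd.comp (fst.comp (Primrec.of_equiv (e := Rule.equivProd))))).of_eq fun r =>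
      List.cons_head_tail r.head_ne_nil

theorem primrec_rule_atoms : Primrec Rule.atoms :=
  list_append.comp (list_append.comp primrec_rule_head primrec_rule_posBody) primrec_rule_negBody

theorem primrec_rule_vars : Primrec Rule.vars :=
  list_flatMap primrec_rule_atoms (primrec_atom_vars.comp snd).to₂

theorem primrec_rule_subst : Primrec₂ fun (l : List Term) r => Rule.subst (listSubst l) r := by
  have hmap : ∀ {f : Rule → List Atom}, Primrec f → Primrec fun q : List Term × Rule =>
      (f q.2).map (Atom.subst (listSubst q.1)) := fun hf =>
    list_map (hf.comp snd) (primrec_atom_subst.comp (fst.comp fst) snd)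
  have he : Primrec fun q : List Term × Rule => Rule.equivProd q.2 :=
    (Primrec.of_equiv (e := Rule.equivProd)).comp snd
  refine (Primrec.of_equiv_iff Rule.equivProd).1 ((Primrec.pair (Primrec.pair
    (primrec_atom_subst.comp fst (fst.comp (fst.comp he))) (list_tail.comp
      (hmap primrec_rule_head))) ((hmap primrec_rule_posBody).pair
        (hmap primrec_rule_negBody))).of_eq fun q => ?_)
  obtain ⟨l, ⟨_ | ⟨a, as⟩, hne, pos, neg⟩⟩ := q
  · exact absurd rfl hne
  · rfl

theorem primrec_lists : Primrec₂ (lists : List α → ℕ → List (List α)) := by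
  refine (nat_rec (f := fun _ : List α => [[]]) (g := fun T q => [] :: T.flatMap fun t =>
    q.2.map (t :: ·)) (const _) (list_cons.comp (const []) (list_flatMap fst
      (list_map (snd.comp (snd.comp fst)) (list_cons.comp (snd.comp fst) snd))))).of_eq
        fun T n => ?_
  induction n with
  | zero => rfl
  | succ n ih => simp only [lists, ← ih]

theorem primrec_terms : Primrec terms := list_map list_range (primrec_ofNat.comp snd).to₂

theorem primrec_functors :
    Primrec fun P : Program => P.flatMap fun r => r.atoms.flatMap Atom.functors :=
  list_flatMap Primrec.id (list_flatMap (primrec_rule_atoms.comp snd)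
    (primrec_atom_functors.comp snd).to₂).to₂

theorem forall_mem_flatMap_functors {P : Program} {p : ℕ × ℕ → Prop} :
    (∀ f ∈ P.flatMap fun r => r.atoms.flatMap Atom.functors, p f) ↔
      ∀ r ∈ P, ∀ a ∈ r.atoms, ∀ f ∈ a.functors, p f := by
  simp only [List.mem_flatMap]
  exact ⟨fun h r hr a ha f hf => h f ⟨r, hr, a, ha, hf⟩,
    fun h f ⟨r, hr, a, ha, hf⟩ => h r hr a ha f hf⟩

theorem primrecRel_inUniverse : PrimrecRel fun (P : Program) (t : Term) =>
    t.vars = [] ∧ ∀ f ∈ t.functors, ∃ r ∈ P, ∃ a ∈ r.atoms, f ∈ a.functors := by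
  refine (PrimrecPred.and (Primrec.eq.comp (primrec_term_vars.comp snd) (const []))
    (PrimrecPred.forall_mem (primrec_term_functors.comp snd) (p := fun q f =>
      f ∈ q.1.flatMap fun r => r.atoms.flatMap Atom.functors) (PrimrecPred.mem
      (primrec_functors.comp (fst.comp fst)) snd))).of_eq fun q => ?_
  simp only [List.mem_flatMap]

theorem primrecPred_dominates {P : γ → Program} {K : γ → ℕ} {R : γ → List Atom}
    (hP : Primrec P) (hK : Primrec K) (hR : Primrec R) :
    PrimrecPred fun c => Dominates (P c) (K c) (R c) := by
  refine PrimrecPred.or ?_ (PrimrecPred.or ?_ ?_)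
  · refine PrimrecPred.exists_mem (primrec_terms.comp hK) (PrimrecPred.and
      (primrecRel_inUniverse.comp (hP.comp fst) snd)
      (PrimrecPred.forall_mem (hR.comp fst) (PrimrecPred.forall_mem
        (primrec_atom_args.comp snd) ?_)))
    exact nat_lt.comp (primrec_toNat.comp snd) (primrec_toNat.comp (snd.comp (fst.comp fst)))
  · refine (PrimrecPred.forall_mem (primrec_functors.comp hP) (p := fun c f =>
      f.2 = 0 ∧ (Term.fn f.1 []).toNat < K c) (PrimrecPred.and
        (Primrec.eq.comp (snd.comp snd) (const 0)) (nat_lt.comp (primrec_toNat.comp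
          (primrec_fn.comp (fst.comp snd) (const []))) (hK.comp fst)))).of_eq
            fun c => forall_mem_flatMap_functors
  · exact (PrimrecPred.forall_mem (primrec_functors.comp hP) (p := fun _ f => f.2 ≠ 0)
      (PrimrecPred.not (Primrec.eq.comp (snd.comp snd) (const 0)))).of_eq
        fun c => forall_mem_flatMap_functors

theorem primrecPred_forall_instancesBelow {P : γ → Program} {K : γ → ℕ} {p : γ → Rule → Prop}
    (hP : Primrec P) (hK : Primrec K) (hp : PrimrecRel p) :
    PrimrecPred fun c => ∀ r ∈ instancesBelow (P c) (K c), p c r := by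
  have h : PrimrecPred fun c => ∀ r ∈ P c, ∀ l ∈ lists (terms (K c)) (K c),
      (∀ x ∈ r.vars, (fun (P : Program) (t : Term) => t.vars = [] ∧ ∀ f ∈ t.functors,
        ∃ r ∈ P, ∃ a ∈ r.atoms, f ∈ a.functors) (P c) (listSubst l x)) →
      p c (r.subst (listSubst l)) := by
    refine PrimrecPred.forall_mem hP (PrimrecPred.forall_mem
      (primrec_lists.comp (primrec_terms.comp (hK.comp fst)) (hK.comp fst))
      (PrimrecPred.imp (PrimrecPred.forall_mem (primrec_rule_vars.comp (snd.comp fst)) ?_) ?_))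
    · exact primrecRel_inUniverse.comp (hP.comp (fst.comp (fst.comp fst)))
        (primrec_listSubst.comp (snd.comp fst) snd)
    · exact hp.comp (fst.comp fst) (primrec_rule_subst.comp snd (snd.comp fst))
  refine h.of_eq fun c => ?_
  constructor
  · rintro h _ ⟨r, hr, l, hl, hx, rfl⟩
    exact h r hr l hl fun x hxr => (inUniverse_iff _).1 (hx x hxr)
  · exact fun h r hr l hl hx => h _ ⟨r, hr, l, hl, fun x hxr => (inUniverse_iff _).2 (hx x hxr), rfl⟩

theorem primrecPred_satisfiesReduct {R M N : γ → List Atom} {r : γ → Rule} (hR : Primrec R)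
    (hM : Primrec M) (hN : Primrec N) (hr : Primrec r) :
    PrimrecPred fun c => SatisfiesReduct (R c) (M c) (N c) (r c) :=
  PrimrecPred.imp
    (PrimrecPred.exists_mem (primrec_rule_head.comp hr) (PrimrecPred.mem (hR.comp fst) snd)) <|
  PrimrecPred.imp (PrimrecPred.forall_mem (primrec_rule_negBody.comp hr)
    (PrimrecPred.mem (hM.comp fst) snd).not) <|
  PrimrecPred.imp (PrimrecPred.forall_mem (primrec_rule_posBody.comp hr)
    (PrimrecPred.mem (hN.comp fst) snd))
  (PrimrecPred.exists_mem (primrec_rule_head.comp hr) (PrimrecPred.mem (hN.comp fst) snd))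

theorem primrecPred_isListAnswerSet {P : γ → Program} {K : γ → ℕ} {R X : γ → List Atom}
    (hP : Primrec P) (hK : Primrec K) (hR : Primrec R) (hX : Primrec X) :
    PrimrecPred fun c => IsListAnswerSet (P c) (K c) (R c) (X c) := by
  refine PrimrecPred.and (primrecPred_forall_instancesBelow hP hK (primrecPred_satisfiesReduct
    (hR.comp fst) (hX.comp fst) (hX.comp fst) snd)) (PrimrecPred.forall_mem
      (primrec_lists.comp hX (list_length.comp hX)) (PrimrecPred.imp
        (primrecPred_forall_instancesBelow (hP.comp fst) (hK.comp fst) ?_)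
        (PrimrecPred.forall_mem (hX.comp fst) (PrimrecPred.mem (snd.comp fst) snd))))
  exact primrecPred_satisfiesReduct (hR.comp (fst.comp fst)) (hX.comp (fst.comp fst))
    (snd.comp fst) snd

theorem primrecPred_isCertificate {P : γ → Program} {Q : γ → Atom} {K : γ → ℕ}
    {R : γ → List Atom} (hP : Primrec P) (hQ : Primrec Q) (hK : Primrec K) (hR : Primrec R) :
    PrimrecPred fun c => IsCertificate (P c) (Q c) (K c) (R c) := by
  refine (PrimrecPred.mem hR hQ).and (PrimrecPred.and (PrimrecPred.forall_mem hP
    (PrimrecPred.forall_mem (primrec_rule_vars.comp snd) (nat_lt.comp snd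
      (hK.comp (fst.comp fst))))) ((primrecPred_dominates hP hK hR).and
        (primrecPred_forall_instancesBelow hP hK (PrimrecPred.imp ?_ ?_))))
  · exact PrimrecPred.exists_mem (primrec_rule_head.comp snd)
      (PrimrecPred.mem (hR.comp (fst.comp fst)) snd)
  · exact PrimrecPred.forall_mem (primrec_rule_atoms.comp snd)
      (PrimrecPred.mem (hR.comp (fst.comp fst)) snd)

end Primrec

/-! ### Search for a certificate -/

/-- A property that can be read off primitive recursively from any certificate, certificates
being primitive recursively recognizable, is decidable on the inputs that have one. -/
theorem decidableOn_of_certificate {α β : Type*} [Primcodable α] [Primcodable β]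
    {D p : α → Prop} {cert q : α → β → Prop} (hcert : PrimrecRel cert) (hq : PrimrecRel q)
    (hex : ∀ a, D a → ∃ b, cert a b) (hpq : ∀ a b, D a → cert a b → (q a b ↔ p a)) :
    DecidableOn D p := by
  classical
  -- Codes that are not certificates yield `none` and are skipped; the first certificate supplies
  -- the answer.
  let f : α → ℕ → Option Bool := fun a n =>
    (Encodable.decode (α := β) n).bind fun b => if cert a b then some (decide (q a b)) else none
  have hf : Primrec₂ f := Primrec.option_bind (Primrec.decode.comp Primrec.snd)
    (Primrec.ite (hcert.comp (Primrec.fst.comp Primrec.fst) Primrec.snd)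
      (Primrec.option_some.comp (PrimrecPred.decide
        (hq.comp (Primrec.fst.comp Primrec.fst) Primrec.snd))) (Primrec.const none))
  refine ⟨fun a => Nat.rfindOpt (f a), Partrec.rfindOpt hf.to_comp, fun a ha => ?_⟩
  have hdom : (Nat.rfindOpt (f a)).Dom := by
    obtain ⟨b, hb⟩ := hex a ha
    exact Nat.rfindOpt_dom.2 ⟨Encodable.encode b, decide (q a b), by simp [f, hb]⟩
  obtain ⟨c, hc⟩ := Part.dom_iff_mem.1 hdom
  refine ⟨c, hc, ?_⟩
  obtain ⟨n, hn⟩ := Nat.rfindOpt_spec hc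
  obtain ⟨b, -, hb⟩ := Option.bind_eq_some_iff.1 (Option.mem_def.1 hn)
  split_ifs at hb with hab
  rw [← hpq a b ha hab, ← Option.some.inj hb, decide_eq_true_iff]

theorem primrecRel_isCertificate : PrimrecRel fun (x : Program × Atom) (c : ℕ × List Atom) =>
    IsCertificate x.1 x.2 c.1 c.2 := by
  open Primrec in
  exact primrecPred_isCertificate (fst.comp fst) (snd.comp fst) (fst.comp snd) (snd.comp snd)

theorem primrecRel_forall_isListAnswerSet {p : Atom → List Atom → Prop} (hp : PrimrecRel p) :
    PrimrecRel fun (x : Program × Atom) (c : ℕ × List Atom) =>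
      ∀ X ∈ lists c.2 c.2.length, IsListAnswerSet x.1 c.1 c.2 X → p x.2 X := by
  open Primrec in
  exact PrimrecPred.forall_mem (primrec_lists.comp (snd.comp snd)
    (list_length.comp (snd.comp snd))) (PrimrecPred.imp (primrecPred_isListAnswerSet
      (fst.comp (fst.comp fst)) (fst.comp (snd.comp fst)) (snd.comp (snd.comp fst)) snd)
        (hp.comp (snd.comp (fst.comp fst)) snd))

end ASP

theorem mainTheorem1 :
    ASP.DecidableOn ASP.IsFinitelyRecursiveInstance
        (fun x : ASP.Program × ASP.Atom => ASP.CautiouslyEntails x.1 x.2) ∧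
      ASP.DecidableOn ASP.IsFinitelyRecursiveInstance
        (fun x : ASP.Program × ASP.Atom => ASP.BravelyEntails x.1 x.2) := by
  have hex : ∀ x, ASP.IsFinitelyRecursiveInstance x →
      ∃ c : ℕ × List ASP.Atom, ASP.IsCertificate x.1 x.2 c.1 c.2 := fun x hx => by
    obtain ⟨K, R, h⟩ := ASP.exists_isCertificate hx.2.2
    exact ⟨(K, R), h⟩
  constructor
  · exact ASP.decidableOn_of_certificate ASP.primrecRel_isCertificate
      (ASP.primrecRel_forall_isListAnswerSet (p := fun Q X => Q ∈ X)
        (PrimrecPred.mem Primrec.snd Primrec.fst)) hex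
      fun x c hx hc => (hc.cautiouslyEntails_iff hx.1).symm
  · exact ASP.decidableOn_of_certificate ASP.primrecRel_isCertificate
      (ASP.primrecRel_forall_isListAnswerSet (p := fun Q X => Q ∉ X)
        (PrimrecPred.mem Primrec.snd Primrec.fst).not).not hex
      fun x c hx hc => (hc.bravelyEntails_iff hx.1).symm
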